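/- Let $m,d\ge 0$ be integers, let $\alpha\in\mathbb R\setminus\mathbb Q$ and $\lambda=e^{2\pi i\alpha}$. For every multi-index $i=(i_1,\dots,i_m)\in\mathbb N^m$ with $i_1+\dots+i_m\le d$ let $f_i:\mathbb C\to\mathbb C$ be an entire function with $f_i(0)=f_i'(0)=0$, and consider the polynomial family of entire functions $$f_t(z)=\lambda z+\sum_{i_1+\dots+i_m\le d} t_1^{i_1}\cdots t_m^{i_m}\, f_i(z),\qquad t=(t_1,\dots,t_m)\in\mathbb C^m,$$ so that $f_t(0)=0$ and $f_t'(0)=\lambda$. Call $f_t$ linearizable if there is a germ $h$ of holomorphic function at $0\in\mathbb C$ with $h(0)=0$, $h'(0)=1$ and $h\circ f_t=\lambda h$ near $0$. Then at least one of the following holds: 1. $f_t$ is linearizable for every $t\in\mathbb C^m$; 2. there is a set $E\subset\mathbb C^m$ that is polar and of $\Gamma$-capacity $0$ such that $f_t$ is not linearizable for any $t\in\mathbb C^m\setminus E$. Here $E\subset\mathbb C^m$ is called polar (pluripolar if $m\ge2$) if there is a plurisubharmonic function $u:\mathbb C^m\to[-\infty,\infty)$, not identically $-\infty$, with $u=-\infty$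 on $E$; for $m=1$ this is the usual notion of a polar subset of $\mathbb C$. The $\Gamma$-capacity of $E\subset\mathbb C^n$ is $\sup_U\gamma_n(U(E))$ over all unitary transformations $U$ of $\mathbb C^n$, where $\gamma_1$ is the logarithmic capacity on $\mathbb C$ and $\gamma_{n+1}(E)$ is the logarithmic capacity of $\{w\in\mathbb C:\gamma_n(\{z\in\mathbb C^n:(w,z)\in E\})>0\}$; a subset of $\mathbb C$ counts as having logarithmic capacity $0$ exactly when it is polar. (For $n=0$, only the empty set counts as null.) -/

import Mathlib

noncomputable section

/-- The mean value over the circle `{a + e^{2πiθ} b : 0 ≤ θ ≤ 1}` of a function with values in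
`[-∞, ∞]`: the integral of the positive part minus the integral of the negative part.
The first of these is finite when `u` is upper semicontinuous with values in `[-∞, ∞)`. -/
def circleMean {V : Type*} [NormedAddCommGroup V] [NormedSpace ℂ V]
    (u : V → EReal) (a b : V) : EReal :=
  ((∫⁻ θ in Set.Icc (0 : ℝ) 1,
      (u (a + Complex.exp (2 * Real.pi * Complex.I * θ) • b)).toENNReal : ENNReal) : EReal) -
  ((∫⁻ θ in Set.Icc (0 : ℝ) 1,
      (-u (a + Complex.exp (2 * Real.pi * Complex.I * θ) • b)).toENNReal : ENNReal) : EReal)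

/-- Plurisubharmonic functions `u : V → [-∞, ∞)` on a complex normed space; for `V = ℂ`, the
subharmonic functions. The function which is identically `-∞` is allowed. -/
structure IsPlurisubharmonic {V : Type*} [NormedAddCommGroup V] [NormedSpace ℂ V]
    (u : V → EReal) : Prop where
  upperSemicontinuous : UpperSemicontinuous u
  ne_top : ∀ z, u z ≠ ⊤
  le_circleMean : ∀ a b : V, u a ≤ circleMean u a b

/-- Polar subsets of `ℂ` (for `V = ℂ`) and pluripolar subsets of `ℂ^m` (for `V = ℂ^m`): sets on
which some plurisubharmonic function, not identically `-∞`, takes the value `-∞`. -/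
def IsPolar {V : Type*} [NormedAddCommGroup V] [NormedSpace ℂ V] (E : Set V) : Prop :=
  ∃ u : V → EReal, IsPlurisubharmonic u ∧ (∃ z, u z ≠ ⊥) ∧ ∀ z ∈ E, u z = ⊥

/-- Vanishing of the coordinate-dependent set function `γ_n` on subsets of `ℂ^n`: `γ_1` is the
logarithmic capacity on `ℂ`, and `γ_{n+1}(E)` is the logarithmic capacity of the set of all `w`
for which the slice `{z ∈ ℂ^n : (w, z) ∈ E}` has `γ_n > 0`. A set of logarithmic capacity zero
in `ℂ` is the same as a polar set. (With `γ_0(E) = 0` for `E = ∅` only, the recursion may be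
started at `n = 0`.) -/
def IteratedCapacityZero : (n : ℕ) → Set (Fin n → ℂ) → Prop
  | 0, E => E = ∅
  | n + 1, E => IsPolar {w : ℂ |
      ¬ IteratedCapacityZero n {z : Fin n → ℂ | (Fin.cons w z : Fin (n + 1) → ℂ) ∈ E}}

/-- `Γ`-capacity zero: the `Γ`-capacity of `E ⊆ ℂ^n` is the supremum of `γ_n (U E)` over all
unitary transformations `U` of `ℂ^n`. -/
def GammaCapacityZero {n : ℕ} (E : Set (EuclideanSpace ℂ (Fin n))) : Prop :=
  ∀ U : EuclideanSpace ℂ (Fin n) ≃ₗᵢ[ℂ] EuclideanSpace ℂ (Fin n),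
    IteratedCapacityZero n {z : Fin n → ℂ | WithLp.toLp 2 z ∈ U '' E}

/-- The multi-indices `i ∈ ℕ^m` with `i_1 + ⋯ + i_m ≤ d`. -/
def multiIndices (m d : ℕ) : Finset (Fin m → ℕ) :=
  (Fintype.piFinset fun _ : Fin m => Finset.range (d + 1)).filter fun i => ∑ j, i j ≤ d

/-- The polynomial family `f_t(z) = lam z + ∑_{|i| ≤ d} t^i f_i(z)`, for `t ∈ ℂ^m`. -/
def polynomialFamily {m : ℕ} (lam : ℂ) (d : ℕ) (f : (Fin m → ℕ) → ℂ → ℂ)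
    (t : EuclideanSpace ℂ (Fin m)) (z : ℂ) : ℂ :=
  lam * z + ∑ i ∈ multiIndices m d, (∏ j, t j ^ i j) * f i z

/-- Holomorphic linearizability at the fixed point `0`: there is a holomorphic germ `h` with
`h(0) = 0` and `h'(0) = 1` (thus a germ of diffeomorphism) such that `h ∘ f = f'(0) h` near `0`. -/
def IsLinearizable (f : ℂ → ℂ) : Prop :=
  ∃ h : ℂ → ℂ, AnalyticAt ℂ h 0 ∧ h 0 = 0 ∧ deriv h 0 = 1 ∧
    ∀ᶠ z in nhds (0 : ℂ), h (f z) = deriv f 0 * h z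

end

/-!
The formal linearization `h_t(z) = z + ∑ h_n(t) z^n` of `f_t` exists because `λ` is not a root of
unity, and its coefficient `h_n(t)` is a polynomial in `t` of degree at most `d (n - 1)`
(`isPolynomialOnLines_linearizationCoeff`). Comparing Taylor coefficients shows that `f_t` is
linearizable exactly if `|h_n(t)| ≤ C ^ n` for some `C` (`isLinearizable_iff`). What remains is a
statement on a sequence of polynomials `h_n` on `ℂ^m` of degree `O(n)`: the set `E` of the `t` at
which `h_n(t)` is exponentially bounded is the whole space, or polar and of `Γ`-capacity zero.

Polarity (`isPolar_boundedGrowthSet`): let `S_n` be the maximum of `|h_n|` over the unit ball. By a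
Bernstein-Walsh estimate `|h_n(t)| ≤ S_n (1 + ‖t‖) ^ (D n)`, so that `S_n ^ (1/n)` is unbounded if
`E` is not everything. Along a subsequence on which `log S_n ≥ 4 ^ j n` put
`w_j = D log (1 + ‖t‖) - (1/n) log (|h_n(t)| / S_n) ≥ 0`. Then
`u = D log (1 + ‖t‖) - ∑ 2 ^ (-j-1) w_j` is plurisubharmonic, being an average of the functions
`(1/n) log (|h_n| / S_n)`, and it is `-∞` on `E`, where `w_j ≥ 4 ^ j - O(1)`. It is finite almost
everywhere in the unit ball, because the integral of `w_j` over the ball of radius `2` around a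
maximum point of `|h_n|` is bounded independently of `j` by the mean value inequality. No convexity
of `D log (1 + ‖t‖)` is used: it cancels from `u`, and serves only to make the `w_j` nonnegative, so
that sums and integrals may be taken in `[0, ∞]`.

Capacity (`iteratedCapacityZero_boundedGrowthSet`): fix `(w₀, z₀) ∉ E`. By induction a slice of `E`
over `w` which is not null is the whole space, so it contains `z₀`; the set of such `w` lies in the
slice of `E` through `z₀`, which is polar by the case of one variable.
-/

open MeasureTheory Polynomial
open scoped NNReal ENNReal

/-! ### Functions that are polynomial on complex lines -/

/-- Continuous functions on a complex normed space whose restriction to every complex line is a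
polynomial of degree at most `N`. On `ℂ^m` these are the polynomials of total degree at most `N`;
this description needs no coordinates and is visibly stable under affine changes of variables. -/
structure IsPolynomialOnLines {V : Type*} [NormedAddCommGroup V] [NormedSpace ℂ V]
    (N : ℕ) (h : V → ℂ) : Prop where
  continuous : Continuous h
  exists_polynomial : ∀ a b : V, ∃ p : ℂ[X], p.natDegree ≤ N ∧ ∀ z : ℂ, h (a + z • b) = p.eval z

namespace IsPolynomialOnLines

variable {V W : Type*} [NormedAddCommGroup V] [NormedSpace ℂ V] [NormedAddCommGroup W]
  [NormedSpace ℂ W] {N M : ℕ} {g h : V → ℂ}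

lemma const (N : ℕ) (c : ℂ) : IsPolynomialOnLines N (fun _ : V => c) :=
  ⟨continuous_const, fun _ _ => ⟨C c, by simp, by simp⟩⟩

lemma mono (hh : IsPolynomialOnLines N h) (hNM : N ≤ M) : IsPolynomialOnLines M h :=
  ⟨hh.continuous, fun a b =>
    let ⟨p, hp, hpz⟩ := hh.exists_polynomial a b
    ⟨p, hp.trans hNM, hpz⟩⟩

lemma add (hg : IsPolynomialOnLines N g) (hh : IsPolynomialOnLines N h) :
    IsPolynomialOnLines N (fun t => g t + h t) := by
  refine ⟨hg.continuous.add hh.continuous, fun a b => ?_⟩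
  obtain ⟨p, hp, hpz⟩ := hg.exists_polynomial a b
  obtain ⟨q, hq, hqz⟩ := hh.exists_polynomial a b
  exact ⟨p + q, natDegree_add_le_of_degree_le hp hq, fun z => by simp [hpz, hqz]⟩

lemma mul (hg : IsPolynomialOnLines N g) (hh : IsPolynomialOnLines M h) :
    IsPolynomialOnLines (N + M) (fun t => g t * h t) := by
  refine ⟨hg.continuous.mul hh.continuous, fun a b => ?_⟩
  obtain ⟨p, hp, hpz⟩ := hg.exists_polynomial a b
  obtain ⟨q, hq, hqz⟩ := hh.exists_polynomial a b
  exact ⟨p * q, natDegree_mul_le_of_le hp hq, fun z => by simp [hpz, hqz]⟩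

lemma const_mul (c : ℂ) (hh : IsPolynomialOnLines N h) :
    IsPolynomialOnLines N (fun t => c * h t) := by
  simpa using (const 0 c).mul hh

lemma sum {ι : Type*} (s : Finset ι) {F : ι → V → ℂ}
    (hF : ∀ i ∈ s, IsPolynomialOnLines N (F i)) :
    IsPolynomialOnLines N (fun t => ∑ i ∈ s, F i t) := by
  classical
  induction s using Finset.induction_on with
  | empty => simpa using const N 0
  | insert i s his ih =>
    simp only [Finset.sum_insert his]
    exact (hF i (by simp)).add (ih fun j hj => hF j (by simp [hj]))

lemma prod {ι : Type*} (s : Finset ι) {F : ι → V → ℂ} {D : ι → ℕ}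
    (hF : ∀ i ∈ s, IsPolynomialOnLines (D i) (F i)) :
    IsPolynomialOnLines (∑ i ∈ s, D i) (fun t => ∏ i ∈ s, F i t) := by
  classical
  induction s using Finset.induction_on with
  | empty => simpa using const 0 1
  | insert i s his ih =>
    simp only [Finset.prod_insert his, Finset.sum_insert his]
    exact (hF i (by simp)).mul (ih fun j hj => hF j (by simp [hj]))

lemma pow (hh : IsPolynomialOnLines N h) (k : ℕ) :
    IsPolynomialOnLines (k * N) (fun t => h t ^ k) := by
  simpa using prod (Finset.range k) (fun _ _ => hh)

lemma clm (l : V →L[ℂ] ℂ) : IsPolynomialOnLines 1 (fun t => l t) :=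
  ⟨l.continuous, fun a b => ⟨C (l b) * X + C (l a), natDegree_linear_le,
    fun z => by simp; ring⟩⟩

lemma comp_affine (hh : IsPolynomialOnLines N h) (l : W →L[ℂ] V) (c : V) :
    IsPolynomialOnLines N (fun t => h (c + l t)) := by
  refine ⟨hh.continuous.comp (by fun_prop), fun a b => ?_⟩
  obtain ⟨p, hp, hpz⟩ := hh.exists_polynomial (c + l a) (l b)
  exact ⟨p, hp, fun z => by rw [← hpz]; simp [add_assoc]⟩

end IsPolynomialOnLines

lemma Polynomial.norm_eval_le_mahlerMeasure {N : ℕ} {p : ℂ[X]} (hp : p.natDegree ≤ N) (z : ℂ) :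
    ‖p.eval z‖ ≤ p.mahlerMeasure * (1 + ‖z‖) ^ N := by
  have h0 := p.mahlerMeasure_nonneg
  calc ‖p.eval z‖ ≤ ∑ k ∈ Finset.range (p.natDegree + 1), ‖p.coeff k * z ^ k‖ := by
        rw [eval_eq_sum_range]; exact norm_sum_le _ _
    _ ≤ ∑ k ∈ Finset.range (p.natDegree + 1),
          p.mahlerMeasure * (‖z‖ ^ k * 1 ^ (p.natDegree - k) * (p.natDegree.choose k)) := by
        refine Finset.sum_le_sum fun k _ => ?_
        rw [norm_mul, norm_pow]
        have := p.norm_coeff_le_choose_mul_mahlerMeasure k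
        calc _ ≤ _ := mul_le_mul_of_nonneg_right this (by positivity)
          _ = _ := by ring
    _ = p.mahlerMeasure * (1 + ‖z‖) ^ p.natDegree := by
        rw [← Finset.mul_sum, ← add_pow, add_comm]
    _ ≤ _ := by
        gcongr
        linarith [norm_nonneg z]

lemma Polynomial.mahlerMeasure_le_of_norm_eval_le {p : ℂ[X]} {S : ℝ} (hS : 0 < S)
    (h : ∀ z : ℂ, ‖z‖ = 1 → ‖p.eval z‖ ≤ S) : p.mahlerMeasure ≤ S := by
  rcases eq_or_ne p 0 with rfl | hp
  · simpa using hS.le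
  -- After division by `S` the integrand `log ‖p‖` is nonpositive, also where `p` vanishes.
  have hc : (C ((S : ℂ)⁻¹) * p) ≠ 0 := by
    simp [hp, hS.ne']
  have h1 : (C ((S : ℂ)⁻¹) * p).logMahlerMeasure ≤ 0 := by
    rw [logMahlerMeasure_def, Real.circleAverage_def, smul_eq_mul]
    refine mul_nonpos_of_nonneg_of_nonpos (by positivity) ?_
    rw [← neg_nonneg, ← intervalIntegral.integral_neg]
    refine intervalIntegral.integral_nonneg (by positivity) fun θ _ => ?_
    refine neg_nonneg.mpr (Real.log_nonpos (norm_nonneg _) ?_)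
    have := h (circleMap 0 1 θ) (by simp)
    rw [eval_mul, eval_C, norm_mul, norm_inv, Complex.norm_real, Real.norm_of_nonneg hS.le,
      inv_mul_le_iff₀ hS]
    simpa using this
  have h2 : (C ((S : ℂ)⁻¹) * p).mahlerMeasure ≤ 1 := by
    rw [mahlerMeasure, if_pos hc]
    exact Real.exp_le_one_iff.mpr h1
  rw [mahlerMeasure_mul, mahlerMeasure_const, norm_inv, Complex.norm_real,
    Real.norm_of_nonneg hS.le, inv_mul_le_iff₀ hS] at h2
  simpa using h2

/-- A weak form of the Bernstein-Walsh inequality: a bound on the unit ball controls a polynomial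
everywhere, in terms of its degree. -/
lemma IsPolynomialOnLines.norm_le {V : Type*} [NormedAddCommGroup V] [NormedSpace ℂ V] {N : ℕ}
    {h : V → ℂ} (hh : IsPolynomialOnLines N h) {S : ℝ} (hS : 0 < S)
    (hb : ∀ t, ‖t‖ ≤ 1 → ‖h t‖ ≤ S) (t : V) : ‖h t‖ ≤ S * (1 + ‖t‖) ^ N := by
  obtain ⟨p, hp, hpz⟩ := hh.exists_polynomial 0 (((‖t‖ : ℂ)⁻¹) • t)
  have hM : p.mahlerMeasure ≤ S := by
    refine mahlerMeasure_le_of_norm_eval_le hS fun z hz => ?_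
    rw [← hpz]
    refine hb _ ?_
    rw [zero_add, norm_smul, norm_smul, hz, one_mul, norm_inv, Complex.norm_real, norm_norm]
    exact inv_mul_le_one
  have ht : h t = p.eval (‖t‖ : ℂ) := by
    rw [← hpz, zero_add, smul_smul]
    rcases eq_or_ne t 0 with rfl | h0
    · simp
    · rw [mul_inv_cancel₀ (by simpa using h0), one_smul]
  rw [ht]
  refine (norm_eval_le_mahlerMeasure hp _).trans ?_
  simp only [Complex.norm_real, norm_norm]
  gcongr

/-! ### Mean values over circles -/

lemma norm_cexp_two_pi (θ : ℝ) : ‖Complex.exp (2 * Real.pi * Complex.I * θ)‖ = 1 := by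
  rw [Complex.norm_exp]; simp

lemma continuous_circlePoint {V : Type*} [NormedAddCommGroup V] [NormedSpace ℂ V] (a b : V) :
    Continuous fun θ : ℝ => a + Complex.exp (2 * Real.pi * Complex.I * θ) • b := by
  fun_prop

lemma cexp_two_pi_eq_circleMap (θ : ℝ) :
    Complex.exp (2 * Real.pi * Complex.I * θ) = circleMap 0 1 (2 * Real.pi * θ) := by
  simp only [circleMap, Complex.ofReal_one, one_mul, zero_add]
  congr 1; push_cast; ring

lemma ae_eval_cexp_ne_zero {p : ℂ[X]} (hp : p ≠ 0) :
    ∀ᵐ θ : ℝ ∂(volume.restrict (Set.Icc 0 1)),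
      p.eval (Complex.exp (2 * Real.pi * Complex.I * θ)) ≠ 0 := by
  rw [restrict_Ico_eq_restrict_Icc.symm, ae_restrict_iff' measurableSet_Ico, ae_iff]
  refine Set.Finite.measure_zero ?_ volume
  refine Set.Finite.of_finite_image (f := fun θ : ℝ => circleMap 0 1 (2 * Real.pi * θ)) ?_ ?_
  · refine (p.roots.toFinset.finite_toSet).subset ?_
    rintro _ ⟨θ, hθ, rfl⟩
    simp only [Set.mem_ofPred_eq, Classical.not_imp, not_not] at hθ
    simp [hp, ← cexp_two_pi_eq_circleMap, hθ.2]
  · intro x hx y hy hxy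
    simp only [Set.mem_ofPred_eq, Classical.not_imp, Set.mem_Ico] at hx hy
    have h2 := Real.two_pi_pos
    refine mul_left_cancel₀ h2.ne' (injOn_circleMap_of_abs_sub_le' (c := 0) one_ne_zero
      (a := 0) (b := 2 * Real.pi) (by simp) ?_ ?_ hxy)
    · exact ⟨by nlinarith [hx.1.1], by nlinarith [hx.1.2]⟩
    · exact ⟨by nlinarith [hy.1.1], by nlinarith [hy.1.2]⟩

lemma integral_log_norm_eval (p : ℂ[X]) :
    IntegrableOn (fun θ : ℝ => Real.log ‖p.eval (Complex.exp (2 * Real.pi * Complex.I * θ))‖)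
      (Set.Icc 0 1) ∧
    ∫ θ in Set.Icc (0 : ℝ) 1, Real.log ‖p.eval (Complex.exp (2 * Real.pi * Complex.I * θ))‖
      = p.logMahlerMeasure := by
  simp only [cexp_two_pi_eq_circleMap]
  have h2 := Real.two_pi_pos
  constructor
  · have := p.intervalIntegrable_mahlerMeasure.comp_mul_left (c := 2 * Real.pi)
    rw [zero_div, div_self h2.ne'] at this
    rwa [intervalIntegrable_iff_integrableOn_Icc_of_le zero_le_one] at this
  · rw [integral_Icc_eq_integral_Ioc, ← intervalIntegral.integral_of_le zero_le_one,
      intervalIntegral.integral_comp_mul_left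
        (fun θ => Real.log ‖p.eval (circleMap 0 1 θ)‖) h2.ne', logMahlerMeasure_def,
      Real.circleAverage_def]
    simp

lemma log_norm_eval_zero_le (p : ℂ[X]) (h0 : p.eval 0 ≠ 0) :
    Real.log ‖p.eval 0‖ ≤ p.logMahlerMeasure := by
  rw [logMahlerMeasure_eq_log_MahlerMeasure]
  refine Real.log_le_log (by simpa using h0) ?_
  have := p.norm_coeff_le_choose_mul_mahlerMeasure 0
  simpa [coeff_zero_eq_eval_zero] using this

/-! ### Plurisubharmonic functions of the form `Φ - W` -/

/-- The pair of a finite function `Φ ≥ 0` and a function `W : V → [0, ∞]` satisfies the sub-mean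
value inequality for the difference `Φ - W` on all circles. Written additively, so that it makes
sense where `W = ∞` and is preserved by averages over `W`. -/
def SubMeanDiff {V : Type*} [NormedAddCommGroup V] [NormedSpace ℂ V]
    (Φ : V → ℝ≥0) (W : V → ℝ≥0∞) : Prop :=
  ∀ a b : V,
    (∫⁻ θ in Set.Icc (0 : ℝ) 1, W (a + Complex.exp (2 * Real.pi * Complex.I * θ) • b)) + Φ a ≤
      (∫⁻ θ in Set.Icc (0 : ℝ) 1, (Φ (a + Complex.exp (2 * Real.pi * Complex.I * θ) • b) : ℝ≥0∞))
        + W a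

section

variable {V : Type*} [NormedAddCommGroup V] [NormedSpace ℂ V]

lemma lintegral_circle_ne_top {Φ : V → ℝ≥0} (hΦ : Continuous Φ) (a b : V) :
    (∫⁻ θ in Set.Icc (0 : ℝ) 1,
      (Φ (a + Complex.exp (2 * Real.pi * Complex.I * θ) • b) : ℝ≥0∞)) ≠ ⊤ := by
  have hc : Continuous fun θ : ℝ => Φ (a + Complex.exp (2 * Real.pi * Complex.I * θ) • b) :=
    hΦ.comp (continuous_circlePoint a b)
  obtain ⟨M, hM⟩ := (isCompact_Icc (a := (0 : ℝ)) (b := 1)).bddAbove_image hc.continuousOn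
  have hM' : ∀ θ ∈ Set.Icc (0 : ℝ) 1,
      (Φ (a + Complex.exp (2 * Real.pi * Complex.I * θ) • b) : ℝ≥0∞) ≤ M := fun θ hθ =>
    ENNReal.coe_le_coe.mpr (hM ⟨θ, hθ, rfl⟩)
  refine ne_top_of_le_ne_top ?_ (setLIntegral_mono measurable_const hM')
  simp

lemma EReal.toENNReal_coe_sub_coe (x y : ℝ≥0∞) (hx : x ≠ ⊤) :
    ((x : EReal) - (y : EReal)).toENNReal = x - y := by
  rcases eq_or_ne y ⊤ with rfl | hy
  · lift x to ℝ≥0 using hx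
    simp
  · rw [EReal.toENNReal_sub (EReal.coe_ennreal_nonneg _)]
    simp

lemma EReal.toENNReal_neg_coe_sub_coe (x y : ℝ≥0∞) (hx : x ≠ ⊤) :
    (-((x : EReal) - (y : EReal))).toENNReal = y - x := by
  rw [EReal.neg_sub (by simp) (by simp [hx]), add_comm, ← sub_eq_add_neg,
    EReal.toENNReal_sub (EReal.coe_ennreal_nonneg _)]
  simp

theorem SubMeanDiff.isPlurisubharmonic {Φ : V → ℝ≥0} {W : V → ℝ≥0∞} (h : SubMeanDiff Φ W)
    (hΦ : Continuous Φ) (hW : LowerSemicontinuous W) (hWm : ∀ a b : V, Measurable fun θ : ℝ =>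
      W (a + Complex.exp (2 * Real.pi * Complex.I * θ) • b)) :
    IsPlurisubharmonic fun z => (((Φ z : ℝ≥0∞) : EReal) - (W z : EReal)) := by
  refine ⟨?_, ?_, ?_⟩
  · have h1 : Continuous fun z => ((Φ z : ℝ≥0∞) : EReal) :=
      continuous_coe_ennreal_ereal.comp (ENNReal.continuous_coe.comp hΦ)
    have h2 : UpperSemicontinuous fun z => -(W z : EReal) :=
      (continuous_neg.comp continuous_coe_ennreal_ereal).comp_lowerSemicontinuous_antitone hW
        fun x y hxy => EReal.neg_le_neg_iff.mpr (EReal.coe_ennreal_le_coe_ennreal_iff.mpr hxy)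
    refine h1.upperSemicontinuous.add' h2 fun z => EReal.continuousAt_add ?_ ?_
    · simp
    · simp
  · intro z
    refine ne_top_of_le_ne_top (b := ((Φ z : ℝ≥0∞) : EReal)) (by simp) ?_
    simpa using EReal.sub_le_sub (le_refl ((Φ z : ℝ≥0∞) : EReal)) (EReal.coe_ennreal_nonneg (W z))
  · intro a b
    set P : ℝ → ℝ≥0∞ := fun θ => Φ (a + Complex.exp (2 * Real.pi * Complex.I * θ) • b) with hP
    set Q : ℝ → ℝ≥0∞ := fun θ => W (a + Complex.exp (2 * Real.pi * Complex.I * θ) • b) with hQ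
    have hPm : Measurable P :=
      (ENNReal.continuous_coe.comp (hΦ.comp (continuous_circlePoint a b))).measurable
    have hQm : Measurable Q := hWm a b
    have hPfin : ∫⁻ θ in Set.Icc (0 : ℝ) 1, P θ ≠ ⊤ := lintegral_circle_ne_top hΦ a b
    have hab : (∫⁻ θ in Set.Icc (0 : ℝ) 1, Q θ) + Φ a ≤ (∫⁻ θ in Set.Icc (0 : ℝ) 1, P θ) + W a :=
      h a b
    have hmean : circleMean (fun z => (((Φ z : ℝ≥0∞) : EReal) - (W z : EReal))) a b =
        ((∫⁻ θ in Set.Icc (0 : ℝ) 1, (P θ - Q θ) : ℝ≥0∞) : EReal) -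
          ((∫⁻ θ in Set.Icc (0 : ℝ) 1, (Q θ - P θ) : ℝ≥0∞) : EReal) := by
      simp only [circleMean, hP, hQ]
      congr 3
      · ext θ; exact EReal.toENNReal_coe_sub_coe _ _ ENNReal.coe_ne_top
      · ext θ; exact EReal.toENNReal_neg_coe_sub_coe _ _ ENNReal.coe_ne_top
    rw [hmean]
    rcases eq_or_ne (W a) ⊤ with hWa | hWa
    · simp [hWa]
    have hQfin : ∫⁻ θ in Set.Icc (0 : ℝ) 1, Q θ ≠ ⊤ :=
      ne_top_of_le_ne_top (ENNReal.add_ne_top.mpr ⟨hPfin, hWa⟩) (le_self_add.trans hab)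
    -- Both sums are the integral of `max P Q`.
    have hmax : (∫⁻ θ in Set.Icc (0 : ℝ) 1, (P θ - Q θ)) + ∫⁻ θ in Set.Icc (0 : ℝ) 1, Q θ =
        (∫⁻ θ in Set.Icc (0 : ℝ) 1, (Q θ - P θ)) + ∫⁻ θ in Set.Icc (0 : ℝ) 1, P θ := by
      rw [← lintegral_add_right _ hQm, ← lintegral_add_right _ hPm]
      simp only [tsub_add_eq_max, max_comm]
    have hA : ∫⁻ θ in Set.Icc (0 : ℝ) 1, (P θ - Q θ) ≠ ⊤ :=
      ne_top_of_le_ne_top hPfin (lintegral_mono fun _ => tsub_le_self)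
    have hB : ∫⁻ θ in Set.Icc (0 : ℝ) 1, (Q θ - P θ) ≠ ⊤ :=
      ne_top_of_le_ne_top hQfin (lintegral_mono fun _ => tsub_le_self)
    generalize (∫⁻ θ in Set.Icc (0 : ℝ) 1, (P θ - Q θ)) = A at *
    generalize (∫⁻ θ in Set.Icc (0 : ℝ) 1, (Q θ - P θ)) = B at *
    generalize (∫⁻ θ in Set.Icc (0 : ℝ) 1, P θ) = IP at *
    generalize (∫⁻ θ in Set.Icc (0 : ℝ) 1, Q θ) = IQ at *
    generalize W a = w at *
    lift A to ℝ≥0 using hA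
    lift B to ℝ≥0 using hB
    lift IP to ℝ≥0 using hPfin
    lift IQ to ℝ≥0 using hQfin
    lift w to ℝ≥0 using hWa
    norm_cast at hmax hab
    have h1 : (A : ℝ) + IQ = B + IP := by exact_mod_cast hmax
    have h2 : (IQ : ℝ) + Φ a ≤ IP + w := by exact_mod_cast hab
    have h3 : (Φ a : ℝ) - w ≤ A - B := by linarith
    have h4 : (((Φ a : ℝ) - w : ℝ) : EReal) ≤ ((A - B : ℝ) : EReal) := EReal.coe_le_coe_iff.mpr h3
    rw [EReal.coe_sub, EReal.coe_sub] at h4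
    simpa only [EReal.coe_nnreal_eq_coe_real] using h4

/-- A convex combination of functions with the sub-mean value property has it again. -/
lemma SubMeanDiff.tsum {Φ : V → ℝ≥0} {w : ℕ → V → ℝ≥0∞} (h : ∀ j, SubMeanDiff Φ (w j))
    (hw : ∀ j, Continuous (w j)) {q : ℕ → ℝ≥0∞} (hq : ∑' j, q j = 1) :
    SubMeanDiff Φ fun z => ∑' j, q j * w j z := by
  intro a b
  have hm : ∀ j, Measurable fun θ : ℝ =>
      w j (a + Complex.exp (2 * Real.pi * Complex.I * θ) • b) := fun j =>
    ((hw j).comp (continuous_circlePoint a b)).measurable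
  rw [lintegral_tsum fun j => ((hm j).const_mul _).aemeasurable]
  simp only [lintegral_const_mul _ (hm _)]
  have h1 : ∀ x : ℝ≥0∞, x = ∑' j, q j * x := fun x => by rw [ENNReal.tsum_mul_right, hq, one_mul]
  rw [h1 (Φ a), h1 (∫⁻ θ in Set.Icc (0 : ℝ) 1, _), ← ENNReal.tsum_add, ← ENNReal.tsum_add]
  refine ENNReal.tsum_le_tsum fun j => ?_
  rw [← mul_add, ← mul_add]
  exact mul_le_mul' le_rfl (h j a b)

end

/-! ### Solid mean values -/

section

variable {V : Type*} [NormedAddCommGroup V] [NormedSpace ℂ V] [FiniteDimensional ℂ V]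
  [MeasurableSpace V] [BorelSpace V]

lemma measurePreserving_rotation (μ : Measure V) [μ.IsAddHaarMeasure] {ζ : ℂ} (hζ : ‖ζ‖ = 1) :
    MeasurePreserving (fun b : V => ζ • b) μ μ := by
  have : ProperSpace V := FiniteDimensional.proper ℂ V
  have h0 : ζ ≠ 0 := by rintro rfl; simp at hζ
  let e : V ≃L[ℂ] V := ContinuousLinearEquiv.smulLeft (Units.mk0 ζ h0)
  refine ⟨by fun_prop, ?_⟩
  have he : ∀ b, e b = ζ • b := fun b => rfl
  have hmap : (μ.map fun b : V => ζ • b).IsAddHaarMeasure := e.isAddHaarMeasure_map μ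
  have hsmul := Measure.isAddLeftInvariant_eq_smul (μ.map fun b : V => ζ • b) μ
  -- The scalar is `1`, as the unit ball is invariant.
  have hball : (μ.map fun b : V => ζ • b) (Metric.closedBall 0 1) = μ (Metric.closedBall 0 1) := by
    rw [Measure.map_apply (by fun_prop) measurableSet_closedBall]
    congr 1
    ext b
    simp [norm_smul, hζ]
  rw [hsmul] at hball ⊢
  have hpos : μ (Metric.closedBall (0 : V) 1) ≠ 0 :=
    (Metric.measure_closedBall_pos μ 0 one_pos).ne'
  have hfin : μ (Metric.closedBall (0 : V) 1) ≠ ⊤ := measure_closedBall_lt_top.ne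
  have hone : ((Measure.addHaarScalarFactor (μ.map fun b : V => ζ • b) μ : ℝ≥0) : ℝ≥0∞) = 1 := by
    rw [Measure.smul_apply, ENNReal.smul_def, smul_eq_mul] at hball
    exact (ENNReal.mul_eq_right hpos hfin).mp hball
  rw [ENNReal.coe_eq_one.mp hone, one_smul]

/-- The sub-mean value inequality over balls follows from the one over circles, as Haar measure is
invariant under `b ↦ e^{2πiθ} b`. -/
lemma SubMeanDiff.lintegral_ball_le (μ : Measure V) [μ.IsAddHaarMeasure] {Φ : V → ℝ≥0}
    {w : V → ℝ≥0∞} (h : SubMeanDiff Φ w) (hw : Measurable w) (a : V) (R : ℝ) {M : ℝ≥0}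
    (hM : ∀ b, ‖b‖ ≤ R → Φ (a + b) ≤ M) :
    ∫⁻ b in Metric.closedBall 0 R, w (a + b) ∂μ ≤ (M + w a) * μ (Metric.closedBall 0 R) := by
  have hrot : ∀ θ : ℝ, ∫⁻ b in Metric.closedBall 0 R, w (a + b) ∂μ =
      ∫⁻ b in Metric.closedBall 0 R,
        w (a + Complex.exp (2 * Real.pi * Complex.I * θ) • b) ∂μ := fun θ => by
    have hp := (measurePreserving_rotation μ (norm_cexp_two_pi θ))
    have := (hp.restrict_preimage (s := Metric.closedBall 0 R)
      measurableSet_closedBall).lintegral_comp (f := fun b => w (a + b)) (by fun_prop)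
    rw [← this]
    congr 2
    ext b
    simp [norm_smul, norm_cexp_two_pi]
  calc ∫⁻ b in Metric.closedBall 0 R, w (a + b) ∂μ
      = ∫⁻ θ in Set.Icc (0 : ℝ) 1, ∫⁻ b in Metric.closedBall 0 R,
          w (a + Complex.exp (2 * Real.pi * Complex.I * θ) • b) ∂μ := by
        simp only [← hrot]; simp
    _ = ∫⁻ b in Metric.closedBall 0 R, ∫⁻ θ in Set.Icc (0 : ℝ) 1,
          w (a + Complex.exp (2 * Real.pi * Complex.I * θ) • b) ∂volume ∂μ := by
        have : SecondCountableTopology V := inferInstance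
        refine lintegral_lintegral_swap (Measurable.aemeasurable ?_)
        refine hw.comp ?_
        refine Continuous.measurable ?_
        fun_prop
    _ ≤ ∫⁻ b in Metric.closedBall 0 R, (M + w a) ∂μ := by
        refine setLIntegral_mono measurable_const fun b hb => ?_
        refine le_self_add.trans ((h a b).trans ?_)
        gcongr
        calc _ ≤ ∫⁻ θ in Set.Icc (0 : ℝ) 1, (M : ℝ≥0∞) := by
              refine lintegral_mono fun θ => ENNReal.coe_le_coe.mpr (hM _ ?_)
              simpa [norm_smul, norm_cexp_two_pi] using hb
          _ = M := by simp
    _ = _ := by simp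

end

/-! ### Logarithms of polynomials of controlled growth -/

section

variable {V : Type*} [NormedAddCommGroup V]

/-- The majorant `D log (1 + ‖t‖)` for `(1/n) log |h|`, where `h` is a polynomial of degree at most
`D n` which is bounded by `1` on the unit ball. -/
noncomputable def logGrowth (D : ℕ) (t : V) : ℝ≥0 := Real.toNNReal (D * Real.log (1 + ‖t‖))

/-- The function `-log y`, for `y ≥ 0`, truncated to `[0, ∞]`, with value `∞` at `y = 0`. -/
noncomputable def negLog (y : ℝ) : ℝ≥0∞ := (-ENNReal.log (ENNReal.ofReal y)).toENNReal

/-- The gap between the majorant `D log (1 + ‖t‖)` and `(1/n) log |h / S|`. -/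
noncomputable def logDefect (D n : ℕ) (S : ℝ) (h : V → ℂ) (t : V) : ℝ≥0∞ :=
  ENNReal.ofReal (n : ℝ)⁻¹ * negLog (‖h t‖ / (S * (1 + ‖t‖) ^ (D * n)))

lemma logGrowth_coe (D : ℕ) (t : V) : (logGrowth D t : ℝ) = D * Real.log (1 + ‖t‖) :=
  Real.coe_toNNReal _ (mul_nonneg (by positivity)
    (Real.log_nonneg (by linarith [norm_nonneg t])))

lemma continuous_logGrowth (D : ℕ) : Continuous (logGrowth (V := V) D) := by
  refine continuous_real_toNNReal.comp (continuous_const.mul ?_)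
  refine Continuous.log (by fun_prop) fun t => ?_
  have := norm_nonneg t
  positivity

lemma continuous_negLog : Continuous negLog :=
  (continuous_neg.comp (ENNReal.continuous_log.comp ENNReal.continuous_ofReal)).ereal_toENNReal

lemma negLog_of_pos {y : ℝ} (hy : 0 < y) : negLog y = ENNReal.ofReal (-Real.log y) := by
  rw [negLog, ENNReal.log_ofReal_of_pos hy, ← EReal.coe_neg, EReal.toENNReal_of_ne_top (by simp),
    EReal.toReal_coe]

lemma negLog_zero : negLog 0 = ⊤ := by simp [negLog]

variable {D n : ℕ} {S : ℝ} {h : V → ℂ}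

lemma continuous_logDefect (hS : 0 < S) (hh : Continuous h) :
    Continuous (logDefect D n S h) := by
  refine (ENNReal.continuous_const_mul ENNReal.ofReal_ne_top).comp (continuous_negLog.comp ?_)
  refine hh.norm.div (by fun_prop) fun t => ?_
  have := norm_nonneg t
  positivity

lemma logDefect_of_eq_zero (hn : 0 < n) {t : V} (ht : h t = 0) : logDefect D n S h t = ⊤ := by
  rw [logDefect, ht, norm_zero, zero_div, negLog_zero, ENNReal.mul_top]
  simpa using hn.ne'

lemma logDefect_of_ne_zero (hn : 0 < n) (hS : 0 < S) {t : V} (ht : h t ≠ 0) :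
    logDefect D n S h t =
      ENNReal.ofReal (D * Real.log (1 + ‖t‖) + (Real.log S - Real.log ‖h t‖) / n) := by
  have h1 : 0 < 1 + ‖t‖ := by positivity
  have h2 : 0 < ‖h t‖ := norm_pos_iff.mpr ht
  have hn' : (n : ℝ) ≠ 0 := by positivity
  rw [logDefect, negLog_of_pos (by positivity), ← ENNReal.ofReal_mul (by positivity),
    Real.log_div (by positivity) (by positivity), Real.log_mul (by positivity) (by positivity),
    Real.log_pow]
  congr 1
  push_cast
  field_simp
  ring

lemma log_growth_sub_nonneg (hn : 0 < n) (hS : 0 < S) {t : V} (ht : h t ≠ 0)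
    (hb : ‖h t‖ ≤ S * (1 + ‖t‖) ^ (D * n)) :
    0 ≤ D * Real.log (1 + ‖t‖) + (Real.log S - Real.log ‖h t‖) / n := by
  have h1 : 0 < 1 + ‖t‖ := by positivity
  have h2 : 0 < ‖h t‖ := norm_pos_iff.mpr ht
  have h3 := Real.log_le_log h2 hb
  rw [Real.log_mul (by positivity) (by positivity), Real.log_pow] at h3
  have hn' : (0 : ℝ) < n := by positivity
  have : D * Real.log (1 + ‖t‖) + (Real.log S - Real.log ‖h t‖) / n =
      (Real.log S + (D * n : ℕ) * Real.log (1 + ‖t‖) - Real.log ‖h t‖) / n := by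
    push_cast
    field_simp
    ring
  rw [this]
  exact div_nonneg (by linarith) hn'.le

/-- Subharmonicity of `log |h|` along circles, which is the inequality between the constant
coefficient and the Mahler measure of a polynomial in one variable. -/
lemma subMeanDiff_logDefect [NormedSpace ℂ V] (hn : 0 < n) (hS : 0 < S)
    (hh : IsPolynomialOnLines (D * n) h) (hb : ∀ t, ‖h t‖ ≤ S * (1 + ‖t‖) ^ (D * n)) :
    SubMeanDiff (logGrowth D) (logDefect D n S h) := by
  intro a b
  rcases eq_or_ne (h a) 0 with ha | ha
  · simp [logDefect_of_eq_zero hn ha]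
  obtain ⟨p, -, hp⟩ := hh.exists_polynomial a b
  have hp0 : p.eval 0 = h a := by simp [← hp]
  have hpne : p ≠ 0 := by rintro rfl; simp [← hp0] at ha
  set c : ℝ → V := fun θ => a + Complex.exp (2 * Real.pi * Complex.I * θ) • b with hc
  have hcc : Continuous c := continuous_circlePoint a b
  have hgc : Continuous fun θ => (logGrowth D (c θ) : ℝ) :=
    NNReal.continuous_coe.comp ((continuous_logGrowth D).comp hcc)
  have hgi : IntegrableOn (fun θ => (logGrowth D (c θ) : ℝ)) (Set.Icc 0 1) :=
    hgc.integrableOn_Icc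
  obtain ⟨hli, hl⟩ := integral_log_norm_eval p
  have hle := log_norm_eval_zero_le p (hp0 ▸ ha)
  rw [hp0] at hle
  set r : ℝ → ℝ := fun θ => logGrowth D (c θ) + (Real.log S -
    Real.log ‖p.eval (Complex.exp (2 * Real.pi * Complex.I * θ))‖) / n with hr
  have hri : IntegrableOn r (Set.Icc 0 1) := by
    refine hgi.add (Integrable.div_const (Integrable.sub ?_ hli) _)
    simp
  have hne := ae_eval_cexp_ne_zero hpne
  have hr0 : 0 ≤ᵐ[volume.restrict (Set.Icc (0 : ℝ) 1)] r := by
    filter_upwards [hne] with θ hθ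
    rw [← hp] at hθ
    simpa only [hr, logGrowth_coe, ← hp, Pi.zero_apply] using log_growth_sub_nonneg hn hS hθ (hb _)
  have hw : ∫⁻ θ in Set.Icc (0 : ℝ) 1, logDefect D n S h (c θ) =
      ENNReal.ofReal (∫ θ in Set.Icc (0 : ℝ) 1, r θ) := by
    rw [ofReal_integral_eq_lintegral_ofReal hri hr0]
    refine lintegral_congr_ae ?_
    filter_upwards [hne] with θ hθ
    rw [← hp] at hθ
    rw [logDefect_of_ne_zero hn hS hθ]
    simp only [hr, logGrowth_coe, ← hp, hc]
  have hg : ∫⁻ θ in Set.Icc (0 : ℝ) 1, (logGrowth D (c θ) : ℝ≥0∞) =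
      ENNReal.ofReal (∫ θ in Set.Icc (0 : ℝ) 1, (logGrowth D (c θ) : ℝ)) := by
    rw [ofReal_integral_eq_lintegral_ofReal hgi (ae_of_all _ fun _ => NNReal.coe_nonneg _)]
    simp
  have hint : ∫ θ in Set.Icc (0 : ℝ) 1, r θ =
      (∫ θ in Set.Icc (0 : ℝ) 1, (logGrowth D (c θ) : ℝ)) +
        (Real.log S - p.logMahlerMeasure) / n := by
    have hc1 : IntegrableOn (fun _ : ℝ => Real.log S) (Set.Icc (0 : ℝ) 1) := by simp
    have hd : IntegrableOn (fun θ : ℝ => (Real.log S -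
        Real.log ‖p.eval (Complex.exp (2 * Real.pi * Complex.I * θ))‖) / n) (Set.Icc 0 1) :=
      (Integrable.sub hc1 hli).div_const _
    rw [← hl]
    refine (integral_add hgi hd).trans ?_
    rw [integral_div, integral_sub hc1 hli]
    simp
  have hr0' : 0 ≤ ∫ θ in Set.Icc (0 : ℝ) 1, r θ := integral_nonneg_of_ae hr0
  change (∫⁻ θ in Set.Icc (0 : ℝ) 1, logDefect D n S h (c θ)) + logGrowth D a ≤
    (∫⁻ θ in Set.Icc (0 : ℝ) 1, (logGrowth D (c θ) : ℝ≥0∞)) + logDefect D n S h a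
  have hga : (logGrowth D a : ℝ≥0∞) = ENNReal.ofReal (logGrowth D a : ℝ) := by simp
  rw [hw, hg, logDefect_of_ne_zero hn hS ha, hga, ← ENNReal.ofReal_add hr0' (by positivity),
    ← ENNReal.ofReal_add (by positivity) (log_growth_sub_nonneg hn hS ha (hb a)), ← logGrowth_coe]
  refine ENNReal.ofReal_le_ofReal ?_
  rw [hint]
  have : (Real.log S - p.logMahlerMeasure) / n ≤ (Real.log S - Real.log ‖h a‖) / n := by
    gcongr
  linarith

end

/-! ### Exponentially bounded sequences of polynomials -/

section

variable {V : Type*} [NormedAddCommGroup V] [NormedSpace ℂ V]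

/-- The points at which a sequence of functions grows at most exponentially; for the coefficients
of a power series, the points at which it has a positive radius of convergence. -/
def boundedGrowthSet (h : ℕ → V → ℂ) : Set V := {t | ∃ C : ℝ, ∀ n, 0 < n → ‖h n t‖ ≤ C ^ n}

lemma IsPolar.mono {E F : Set V} (hF : IsPolar F) (h : E ⊆ F) : IsPolar E :=
  let ⟨u, hu, hne, hbot⟩ := hF
  ⟨u, hu, hne, fun z hz => hbot z (h hz)⟩

/-- Total convergence or general divergence: if `h n` is a polynomial of degree at most `D n` and
the sequence `h n t` is not exponentially bounded for every `t`, then it is so only for a polar set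
of `t`. -/
theorem isPolar_boundedGrowthSet [FiniteDimensional ℂ V] {D : ℕ} {h : ℕ → V → ℂ}
    (hh : ∀ n, IsPolynomialOnLines (D * n) (h n)) (hne : boundedGrowthSet h ≠ Set.univ) :
    IsPolar (boundedGrowthSet h) := by
  have : ProperSpace V := FiniteDimensional.proper ℂ V
  let _ : MeasurableSpace V := borel V
  have : BorelSpace V := ⟨rfl⟩
  let μ : Measure V := Measure.addHaar
  obtain ⟨t₀, ht₀⟩ := (Set.ne_univ_iff_exists_notMem _).mp hne
  -- Indices `N j` for which the maximum `‖h (N j) (s j)‖` over the unit ball is huge.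
  have key : ∀ j : ℕ, ∃ n : ℕ, 0 < n ∧ ∃ s : V, ‖s‖ ≤ 1 ∧ (∀ t, ‖t‖ ≤ 1 → ‖h n t‖ ≤ ‖h n s‖) ∧
      (4 : ℝ) ^ j * n ≤ Real.log ‖h n s‖ ∧ h n s ≠ 0 := by
    intro j
    have h1 : 0 < 1 + ‖t₀‖ := by positivity
    have hC : ¬ ∀ n, 0 < n → ‖h n t₀‖ ≤ (Real.exp (4 ^ j) * (1 + ‖t₀‖) ^ D) ^ n := fun hC =>
      ht₀ ⟨_, hC⟩
    push Not at hC
    obtain ⟨n, hn, hlt⟩ := hC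
    obtain ⟨s, hs, hmax⟩ := (isCompact_closedBall (0 : V) 1).exists_isMaxOn
      ⟨0, by simp⟩ (hh n).continuous.norm.continuousOn
    have hmax' : ∀ t, ‖t‖ ≤ 1 → ‖h n t‖ ≤ ‖h n s‖ := fun t ht => hmax (by simpa using ht)
    have hbig : Real.exp (4 ^ j * n) < ‖h n s‖ := by
      by_contra! hle
      have := (hh n).norm_le (Real.exp_pos _) (fun t ht => (hmax' t ht).trans hle) t₀
      rw [mul_comm ((4 : ℝ) ^ j), Real.exp_nat_mul, pow_mul, ← mul_pow] at this
      exact absurd this (not_le.mpr hlt)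
    have hpos : 0 < ‖h n s‖ := (Real.exp_pos _).trans hbig
    exact ⟨n, hn, s, by simpa using hs, hmax', ((Real.lt_log_iff_exp_lt hpos).mpr hbig).le,
      norm_pos_iff.mp hpos⟩
  choose N hN s hs hmax hlog hs0 using key
  have hS : ∀ j, 0 < ‖h (N j) (s j)‖ := fun j => norm_pos_iff.mpr (hs0 j)
  have hb : ∀ j t, ‖h (N j) t‖ ≤ ‖h (N j) (s j)‖ * (1 + ‖t‖) ^ (D * N j) := fun j =>
    (hh _).norm_le (hS j) (hmax j)
  let w : ℕ → V → ℝ≥0∞ := fun j => logDefect D (N j) ‖h (N j) (s j)‖ (h (N j))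
  have hwc : ∀ j, Continuous (w j) := fun j => continuous_logDefect (hS j) (hh _).continuous
  have hwm : ∀ j, SubMeanDiff (logGrowth D) (w j) := fun j =>
    subMeanDiff_logDefect (hN j) (hS j) (hh _) (hb j)
  let q : ℕ → ℝ≥0∞ := fun j => 2⁻¹ ^ (j + 1)
  have hq : ∑' j, q j = 1 := by
    rw [ENNReal.tsum_geometric_add_one, ENNReal.one_sub_inv_two, inv_inv]
    exact ENNReal.inv_mul_cancel (by simp) (by simp)
  let W : V → ℝ≥0∞ := fun z => ∑' j, q j * w j z
  have hWsub : SubMeanDiff (logGrowth D) W := SubMeanDiff.tsum hwm hwc hq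
  have hqc : ∀ j, Continuous fun z => q j * w j z := fun j =>
    (ENNReal.continuous_const_mul (by simp [q])).comp (hwc j)
  have hWlsc : LowerSemicontinuous W := lowerSemicontinuous_tsum fun j =>
    (hqc j).lowerSemicontinuous
  have hWmeas : Measurable W := Measurable.tsum fun j => (hqc j).measurable
  refine ⟨_, hWsub.isPlurisubharmonic (continuous_logGrowth D) hWlsc
    (fun a b => hWmeas.comp (continuous_circlePoint a b).measurable), ?_, ?_⟩
  · -- The mean of `w j` over a ball of radius `2` around the maximum point `s j` is bounded
    -- independently of `j`, and this ball contains the unit ball.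
    let M : ℝ≥0 := Real.toNNReal (D * Real.log 4)
    have hM : ∀ z : V, ‖z‖ ≤ 3 → logGrowth D z ≤ M := fun z hz => by
      refine Real.toNNReal_le_toNNReal ?_
      gcongr
      linarith
    have hws : ∀ j, w j (s j) ≤ M := fun j => by
      change logDefect _ _ _ _ _ ≤ _
      rw [logDefect_of_ne_zero (hN j) (hS j) (hs0 j), sub_self, zero_div, add_zero]
      exact ENNReal.coe_le_coe.mpr (hM (s j) (by linarith [hs j]))
    have hwint : ∀ j, ∫⁻ z in Metric.closedBall 0 1, w j z ∂μ ≤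
        (M + M) * μ (Metric.closedBall 0 2) := by
      intro j
      calc ∫⁻ z in Metric.closedBall 0 1, w j z ∂μ
          ≤ ∫⁻ z in Metric.closedBall (s j) 2, w j z ∂μ := by
            refine lintegral_mono_set (Metric.closedBall_subset_closedBall' ?_)
            rw [dist_zero_left]
            linarith [hs j]
        _ = ∫⁻ b in Metric.closedBall 0 2, w j (s j + b) ∂μ := by
            have := ((measurePreserving_add_left μ (s j)).restrict_preimage
              (s := Metric.closedBall (s j) 2) measurableSet_closedBall).lintegral_comp
              (hwc j).measurable
            rw [← this]
            congr 2
            ext b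
            simp
        _ ≤ (M + w j (s j)) * μ (Metric.closedBall 0 2) := by
            refine (hwm j).lintegral_ball_le μ (hwc j).measurable (s j) 2 fun b hb => hM _ ?_
            linarith [norm_add_le (s j) b, hs j]
        _ ≤ _ := by gcongr; exact hws j
    have hWint : ∫⁻ z in Metric.closedBall 0 1, W z ∂μ ≠ ⊤ := by
      have : ∫⁻ z in Metric.closedBall 0 1, W z ∂μ ≤ (M + M) * μ (Metric.closedBall 0 2) := by
        change ∫⁻ z in Metric.closedBall 0 1, ∑' j, q j * w j z ∂μ ≤ _
        rw [lintegral_tsum fun j => (hqc j).aemeasurable]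
        calc _ ≤ ∑' j, q j * ((M + M) * μ (Metric.closedBall 0 2)) := by
              refine ENNReal.tsum_le_tsum fun j => ?_
              rw [lintegral_const_mul _ (hwc j).measurable]
              exact mul_le_mul' le_rfl (hwint j)
          _ = _ := by rw [ENNReal.tsum_mul_right, hq, one_mul]
      refine ne_top_of_le_ne_top (ENNReal.mul_ne_top (by simp) measure_closedBall_lt_top.ne) this
    have hae := ae_lt_top hWmeas hWint
    have : (ae (μ.restrict (Metric.closedBall 0 1))).NeBot := by
      rw [ae_neBot, Ne, Measure.restrict_eq_zero]
      exact (Metric.measure_closedBall_pos μ 0 one_pos).ne'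
    obtain ⟨z, hz⟩ := hae.exists
    refine ⟨z, ?_⟩
    generalize W z = x at hz ⊢
    lift x to ℝ≥0 using hz.ne
    rw [EReal.coe_nnreal_eq_coe_real, EReal.coe_nnreal_eq_coe_real, ← EReal.coe_sub]
    exact EReal.coe_ne_bot _
  · rintro t ⟨C, hC⟩
    set L : ℝ := Real.log (max |C| 1) with hL
    have hL0 : 0 ≤ L := Real.log_nonneg (le_max_right _ _)
    have hwt : ∀ j, ENNReal.ofReal (4 ^ j - L) ≤ w j t := by
      intro j
      rcases eq_or_ne (h (N j) t) 0 with h0 | h0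
      · exact le_top.trans (logDefect_of_eq_zero (hN j) h0).ge
      refine le_of_le_of_eq (ENNReal.ofReal_le_ofReal ?_)
        (logDefect_of_ne_zero (hN j) (hS j) h0).symm
      have hn : (0 : ℝ) < N j := by exact_mod_cast hN j
      have h1 : Real.log ‖h (N j) t‖ ≤ N j * L := by
        rw [hL, ← Real.log_pow]
        refine Real.log_le_log (norm_pos_iff.mpr h0) ((hC _ (hN j)).trans ?_)
        refine (le_abs_self _).trans ?_
        rw [abs_pow]
        gcongr
        exact le_max_left _ _
      have h2 : 0 ≤ D * Real.log (1 + ‖t‖) := logGrowth_coe D t ▸ NNReal.coe_nonneg _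
      have h3 : 4 ^ j - L ≤ (Real.log ‖h (N j) (s j)‖ - Real.log ‖h (N j) t‖) / N j := by
        rw [le_div_iff₀ hn]
        linarith [hlog j]
      linarith
    have : W t = ⊤ := by
      refine ENNReal.eq_top_of_forall_nnreal_le fun r => ?_
      obtain ⟨j, hj⟩ := pow_unbounded_of_one_lt (4 * r + 2 * L) (one_lt_two : (1 : ℝ) < 2)
      have hqj : q j = ENNReal.ofReal (2⁻¹ ^ (j + 1)) := by
        rw [ENNReal.ofReal_pow (by norm_num), ENNReal.ofReal_inv_of_pos two_pos]
        simp [q]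
      calc (r : ℝ≥0∞) = ENNReal.ofReal r := by simp
        _ ≤ ENNReal.ofReal (2⁻¹ ^ (j + 1) * (4 ^ j - L)) := by
            refine ENNReal.ofReal_le_ofReal ?_
            have h4 : (4 : ℝ) ^ j = 2 ^ j * 2 ^ j := by rw [← mul_pow]; norm_num
            have h5 : (1 : ℝ) ≤ 2 ^ j := one_le_pow₀ one_le_two
            have h6 : (2⁻¹ : ℝ) ^ (j + 1) * (2 ^ j * 2) = 1 := by
              rw [← pow_succ, ← mul_pow]; norm_num
            have h7 : (r : ℝ) * (2 ^ j * 2) ≤ 4 ^ j - L := by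
              rw [h4]
              nlinarith [r.coe_nonneg]
            calc (r : ℝ) = 2⁻¹ ^ (j + 1) * (r * (2 ^ j * 2)) := by linear_combination -(r : ℝ) * h6
              _ ≤ _ := by gcongr
        _ = q j * ENNReal.ofReal (4 ^ j - L) := by
            rw [hqj, ENNReal.ofReal_mul (by positivity)]
        _ ≤ q j * w j t := mul_le_mul' le_rfl (hwt j)
        _ ≤ W t := ENNReal.le_tsum j
    simp [this]

/-- The same alternative for `γ_m`: if the slice over `w` is not null then by induction it is the
whole space, so that `w` lies in a slice of the same kind in the other direction, which is polar. -/
theorem iteratedCapacityZero_boundedGrowthSet {D m : ℕ} {h : ℕ → (Fin m → ℂ) → ℂ}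
    (hh : ∀ n, IsPolynomialOnLines (D * n) (h n)) (hne : boundedGrowthSet h ≠ Set.univ) :
    IteratedCapacityZero m (boundedGrowthSet h) := by
  induction m with
  | zero =>
    change boundedGrowthSet h = ∅
    rw [← Set.not_nonempty_iff_eq_empty]
    rintro ⟨t, ht⟩
    exact hne (Set.eq_univ_of_forall fun t' => Subsingleton.elim t t' ▸ ht)
  | succ m ih =>
    obtain ⟨t₀, ht₀⟩ := (Set.ne_univ_iff_exists_notMem _).mp hne
    let incl : ℂ →L[ℂ] (Fin (m + 1) → ℂ) := ContinuousLinearMap.single ℂ (fun _ => ℂ) 0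
    let tail : (Fin m → ℂ) →L[ℂ] (Fin (m + 1) → ℂ) :=
      ContinuousLinearMap.pi (Fin.cons 0 fun i => ContinuousLinearMap.proj i)
    have hcons : ∀ (x : ℂ) (z : Fin m → ℂ), (Fin.cons x z : Fin (m + 1) → ℂ) =
        incl x + tail z := by
      intro x z
      ext i
      refine Fin.cases ?_ (fun i => ?_) i <;> simp [incl, tail]
    let g : ℕ → ℂ → ℂ := fun n x => h n (tail (Fin.tail t₀) + incl x)
    have hg : ∀ n, IsPolynomialOnLines (D * n) (g n) := fun n => (hh n).comp_affine _ _
    have hgne : boundedGrowthSet g ≠ Set.univ := by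
      intro heq
      have : t₀ 0 ∈ boundedGrowthSet g := heq ▸ Set.mem_univ _
      refine ht₀ ?_
      rw [← Fin.cons_self_tail t₀, hcons, add_comm (incl _)]
      exact this
    refine (isPolar_boundedGrowthSet hg hgne).mono fun x hx => ?_
    by_contra hxg
    refine hx ?_
    have hslice : {z : Fin m → ℂ | (Fin.cons x z : Fin (m + 1) → ℂ) ∈ boundedGrowthSet h} =
        boundedGrowthSet fun n z => h n (incl x + tail z) := by
      ext z
      simp only [hcons]
      rfl
    rw [hslice]
    refine ih (fun n => (hh n).comp_affine _ _) fun huniv => hxg ?_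
    have : Fin.tail t₀ ∈ boundedGrowthSet fun n z => h n (incl x + tail z) :=
      huniv ▸ Set.mem_univ _
    simpa only [boundedGrowthSet, g, Set.mem_ofPred_eq, add_comm] using this

/-- The set of exponential boundedness has zero `Γ`-capacity, since the hypotheses are invariant
under linear changes of variables. -/
theorem gammaCapacityZero_boundedGrowthSet {D m : ℕ} {h : ℕ → EuclideanSpace ℂ (Fin m) → ℂ}
    (hh : ∀ n, IsPolynomialOnLines (D * n) (h n)) (hne : boundedGrowthSet h ≠ Set.univ) :
    GammaCapacityZero (boundedGrowthSet h) := by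
  intro U
  let e : (Fin m → ℂ) ≃L[ℂ] EuclideanSpace ℂ (Fin m) :=
    (EuclideanSpace.equiv (Fin m) ℂ).symm.trans U.symm.toContinuousLinearEquiv
  have hset : {z : Fin m → ℂ | WithLp.toLp 2 z ∈ U '' boundedGrowthSet h} =
      boundedGrowthSet fun n z => h n (0 + (e : (Fin m → ℂ) →L[ℂ] _) z) := by
    ext z
    rw [Set.mem_ofPred_eq, U.image_eq_preimage_symm]
    simp only [zero_add]
    rfl
  rw [hset]
  refine iteratedCapacityZero_boundedGrowthSet (fun n => (hh n).comp_affine _ _) fun huniv => ?_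
  refine hne (Set.eq_univ_of_forall fun t => ?_)
  have : e.symm t ∈ boundedGrowthSet fun n z => h n (0 + (e : (Fin m → ℂ) →L[ℂ] _) z) :=
    huniv ▸ Set.mem_univ _
  simpa [boundedGrowthSet] using this

end

/-! ### Taylor series at the origin -/

/-- The Taylor series at `0` of a function of one complex variable. -/
noncomputable def maclaurin (F : ℂ → ℂ) : PowerSeries ℂ :=
  PowerSeries.mk fun n => iteratedDeriv n F 0 / n.factorial

section

open Filter Topology

variable {F G : ℂ → ℂ}

lemma coeff_maclaurin (F : ℂ → ℂ) (n : ℕ) :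
    PowerSeries.coeff n (maclaurin F) = iteratedDeriv n F 0 / n.factorial := by
  simp [maclaurin]

lemma coeff_zero_maclaurin (F : ℂ → ℂ) : PowerSeries.coeff 0 (maclaurin F) = F 0 := by
  simp [coeff_maclaurin]

lemma coeff_one_maclaurin (F : ℂ → ℂ) : PowerSeries.coeff 1 (maclaurin F) = deriv F 0 := by
  simp [coeff_maclaurin]

lemma maclaurin_congr (h : F =ᶠ[𝓝 0] G) : maclaurin F = maclaurin G := by
  ext n
  rw [coeff_maclaurin, coeff_maclaurin, h.iteratedDeriv_eq]

lemma maclaurin_add (hF : AnalyticAt ℂ F 0) (hG : AnalyticAt ℂ G 0) :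
    maclaurin (fun z => F z + G z) = maclaurin F + maclaurin G := by
  ext n
  simp [coeff_maclaurin, iteratedDeriv_fun_add hF.contDiffAt hG.contDiffAt, add_div]

lemma maclaurin_mul (hF : AnalyticAt ℂ F 0) (hG : AnalyticAt ℂ G 0) :
    maclaurin (fun z => F z * G z) = maclaurin F * maclaurin G := by
  ext n
  simp only [PowerSeries.coeff_mul, coeff_maclaurin,
    iteratedDeriv_fun_mul hF.contDiffAt hG.contDiffAt, Finset.sum_div,
    Finset.Nat.sum_antidiagonal_eq_sum_range_succ_mk, Nat.succ_eq_add_one]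
  refine Finset.sum_congr rfl fun i hi => ?_
  rw [Nat.cast_choose _ (by grind)]
  field_simp [Nat.factorial_ne_zero]

lemma maclaurin_const (c : ℂ) : maclaurin (fun _ => c) = PowerSeries.C c := by
  ext n
  rw [coeff_maclaurin, PowerSeries.coeff_C, iteratedDeriv_const]
  split_ifs with h <;> simp [h]

lemma maclaurin_const_mul (c : ℂ) (hF : AnalyticAt ℂ F 0) :
    maclaurin (fun z => c * F z) = PowerSeries.C c * maclaurin F := by
  rw [maclaurin_mul analyticAt_const hF, maclaurin_const]

lemma maclaurin_pow (hF : AnalyticAt ℂ F 0) (n : ℕ) :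
    maclaurin (fun z => F z ^ n) = maclaurin F ^ n := by
  induction n with
  | zero => simpa using maclaurin_const 1
  | succ n ih =>
    simp only [pow_succ]
    rw [maclaurin_mul (hF.fun_pow n) hF, ih]

lemma maclaurin_sum {ι : Type*} (s : Finset ι) {F : ι → ℂ → ℂ}
    (hF : ∀ i ∈ s, AnalyticAt ℂ (F i) 0) :
    maclaurin (fun z => ∑ i ∈ s, F i z) = ∑ i ∈ s, maclaurin (F i) := by
  ext n
  simp only [coeff_maclaurin, map_sum]
  rw [iteratedDeriv_fun_sum fun i hi => (hF i hi).contDiffAt, Finset.sum_div]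

lemma maclaurin_id : maclaurin (fun z => z) = PowerSeries.X := by
  ext n
  rw [coeff_maclaurin, PowerSeries.coeff_X]
  match n with
  | 0 => simp
  | 1 => simp
  | n + 2 => rw [iteratedDeriv_succ']; simp [iteratedDeriv_const]

lemma eventuallyEq_of_maclaurin_eq (hF : AnalyticAt ℂ F 0) (hG : AnalyticAt ℂ G 0)
    (h : maclaurin F = maclaurin G) : F =ᶠ[𝓝 0] G := by
  have hc : (fun n : ℕ => iteratedDeriv n F 0 / n.factorial) =
      fun n : ℕ => iteratedDeriv n G 0 / n.factorial := by
    ext n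
    rw [← coeff_maclaurin, ← coeff_maclaurin, h]
  have h1 := hF.hasFPowerSeriesAt
  rw [hc] at h1
  have h2 := h1.sub hG.hasFPowerSeriesAt
  rw [sub_self] at h2
  filter_upwards [h2.eventually_eq_zero] with z hz
  exact sub_eq_zero.mp hz

/-- The `k`-th Taylor coefficient of a composition `G ∘ F` with `F 0 = 0`. -/
lemma coeff_maclaurin_comp (hG : AnalyticAt ℂ G 0) (hF : AnalyticAt ℂ F 0) (hF0 : F 0 = 0)
    (k : ℕ) : PowerSeries.coeff k (maclaurin fun z => G (F z)) =
      ∑ n ∈ Finset.range (k + 1),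
        PowerSeries.coeff n (maclaurin G) * PowerSeries.coeff k (maclaurin F ^ n) := by
  obtain ⟨R, hR, hGR⟩ := hG.exists_eventuallyEq_sum_add_pow_mul (k + 1)
  have hRF : AnalyticAt ℂ (fun z => R (F z)) 0 := AnalyticAt.fun_comp (by rwa [hF0]) hF
  have htend : Tendsto F (𝓝 0) (𝓝 0) := by simpa [hF0] using hF.continuousAt.tendsto
  have hcomp : (fun z => G (F z)) =ᶠ[𝓝 0] fun z =>
      (∑ n ∈ Finset.range (k + 1), PowerSeries.coeff n (maclaurin G) * F z ^ n) +
        F z ^ (k + 1) * R (F z) := by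
    filter_upwards [htend.eventually hGR] with z hz
    rw [hz, smul_eq_mul]
    congr 1
    refine Finset.sum_congr rfl fun n _ => ?_
    rw [coeff_maclaurin, smul_eq_mul]
    ring
  have hpow : ∀ n, AnalyticAt ℂ (fun z => F z ^ n) 0 := fun n => hF.fun_pow n
  have hterm : ∀ n ∈ Finset.range (k + 1), AnalyticAt ℂ
      (fun z => PowerSeries.coeff n (maclaurin G) * F z ^ n) 0 := fun n _ =>
    analyticAt_const.fun_mul (hpow n)
  rw [maclaurin_congr hcomp, maclaurin_add (Finset.analyticAt_fun_sum _ hterm)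
    ((hpow _).fun_mul hRF), maclaurin_sum _ hterm, maclaurin_mul (hpow _) hRF, maclaurin_pow hF]
  -- The remainder is divisible by `X ^ (k + 1)`.
  have hX : PowerSeries.X ^ (k + 1) ∣ maclaurin F ^ (k + 1) * maclaurin fun z => R (F z) := by
    refine Dvd.dvd.mul_right (pow_dvd_pow_of_dvd ?_ _) _
    rw [PowerSeries.X_dvd_iff, ← PowerSeries.coeff_zero_eq_constantCoeff_apply,
      coeff_zero_maclaurin, hF0]
  rw [map_add, PowerSeries.X_pow_dvd_iff.mp hX k (by omega), add_zero, map_sum]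
  refine Finset.sum_congr rfl fun n _ => ?_
  rw [maclaurin_const_mul _ (hpow n), maclaurin_pow hF, PowerSeries.coeff_C_mul]

end

/-! ### The formal linearization -/

/-- The coefficients `h_k` of the formal solution `h = X + ⋯` of `h ∘ φ = λ h`, where
`φ = λ X + ⋯`. They are obtained by comparing coefficients of `X ^ k`, which requires
`λ ^ k ≠ λ` for `k ≥ 2`. -/
noncomputable def linearizationCoeff (φ : PowerSeries ℂ) : ℕ → ℂ
  | 0 => 0
  | 1 => 1
  | k + 2 => (∑ n : Fin (k + 2), linearizationCoeff φ n * PowerSeries.coeff (k + 2) (φ ^ (n : ℕ))) /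
      (PowerSeries.coeff 1 φ - PowerSeries.coeff 1 φ ^ (k + 2))

section

variable {φ : PowerSeries ℂ}

lemma linearizationCoeff_of_two_le (φ : PowerSeries ℂ) {k : ℕ} (hk : 2 ≤ k) :
    linearizationCoeff φ k =
      (∑ n ∈ Finset.range k, linearizationCoeff φ n * PowerSeries.coeff k (φ ^ n)) /
        (PowerSeries.coeff 1 φ - PowerSeries.coeff 1 φ ^ k) := by
  obtain ⟨k, rfl⟩ := Nat.exists_eq_add_of_le' hk
  rw [linearizationCoeff, Finset.sum_range]

lemma X_dvd_of_coeff_zero (h0 : PowerSeries.coeff 0 φ = 0) : PowerSeries.X ∣ φ := by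
  rwa [PowerSeries.X_dvd_iff, ← PowerSeries.coeff_zero_eq_constantCoeff_apply]

lemma coeff_pow_of_lt (h0 : PowerSeries.coeff 0 φ = 0) {k n : ℕ} (hkn : k < n) :
    PowerSeries.coeff k (φ ^ n) = 0 :=
  PowerSeries.X_pow_dvd_iff.mp (pow_dvd_pow_of_dvd (X_dvd_of_coeff_zero h0) n) k hkn

lemma coeff_pow_self (h0 : PowerSeries.coeff 0 φ = 0) (k : ℕ) :
    PowerSeries.coeff k (φ ^ k) = PowerSeries.coeff 1 φ ^ k := by
  obtain ⟨ψ, rfl⟩ := X_dvd_of_coeff_zero h0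
  rw [mul_pow, PowerSeries.coeff_X_pow_mul', if_pos le_rfl, Nat.sub_self,
    PowerSeries.coeff_zero_eq_constantCoeff_apply, map_pow]
  congr 1
  rw [show (1 : ℕ) = 0 + 1 from rfl, PowerSeries.coeff_succ_X_mul,
    PowerSeries.coeff_zero_eq_constantCoeff_apply]

/-- The linearization coefficients are the only solution of the formal functional equation. -/
lemma linearizationCoeff_unique_iff (h0 : PowerSeries.coeff 0 φ = 0)
    (hres : ∀ k, 2 ≤ k → PowerSeries.coeff 1 φ ^ k ≠ PowerSeries.coeff 1 φ) (c : ℕ → ℂ) :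
    (c = linearizationCoeff φ) ↔ c 0 = 0 ∧ c 1 = 1 ∧ ∀ k,
      ∑ n ∈ Finset.range (k + 1), c n * PowerSeries.coeff k (φ ^ n) =
        PowerSeries.coeff 1 φ * c k := by
  constructor
  · rintro rfl
    refine ⟨by simp [linearizationCoeff], by simp [linearizationCoeff], fun k => ?_⟩
    match k with
    | 0 => simp [linearizationCoeff]
    | 1 => simp [linearizationCoeff, Finset.sum_range_succ]
    | k + 2 =>
      rw [Finset.sum_range_succ, coeff_pow_self h0,
        linearizationCoeff_of_two_le φ (show 2 ≤ k + 2 by omega)]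
      have := sub_ne_zero.mpr (hres (k + 2) (by omega)).symm
      field_simp
      ring
  · rintro ⟨hc0, hc1, hc⟩
    ext k
    induction k using Nat.strong_induction_on with
    | _ k ih =>
      match k with
      | 0 => simp [hc0, linearizationCoeff]
      | 1 => simp [hc1, linearizationCoeff]
      | k + 2 =>
        have h := hc (k + 2)
        rw [Finset.sum_range_succ, coeff_pow_self h0, Finset.sum_congr rfl fun n hn => by
          rw [ih n (Finset.mem_range.mp hn)]] at h
        rw [linearizationCoeff_of_two_le φ (show 2 ≤ k + 2 by omega),
          eq_div_iff (sub_ne_zero.mpr (hres (k + 2) (by omega)).symm)]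
        linear_combination -h

end

section

open Filter Topology

/-- A germ without resonances is linearizable exactly if its formal linearization converges. -/
theorem isLinearizable_iff {F : ℂ → ℂ} (hF : AnalyticAt ℂ F 0) (hF0 : F 0 = 0)
    (hres : ∀ k, 2 ≤ k → deriv F 0 ^ k ≠ deriv F 0) :
    IsLinearizable F ↔
      ∃ C : ℝ, ∀ n, 0 < n → ‖linearizationCoeff (maclaurin F) n‖ ≤ C ^ n := by
  have h0 : PowerSeries.coeff 0 (maclaurin F) = 0 := by rw [coeff_zero_maclaurin, hF0]
  have h1 : PowerSeries.coeff 1 (maclaurin F) = deriv F 0 := coeff_one_maclaurin F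
  have huniq := linearizationCoeff_unique_iff h0 (by simpa only [h1] using hres)
  rw [h1] at huniq
  constructor
  · rintro ⟨h, hh, hh0, hh1, heq⟩
    have hcoeff : (fun n => PowerSeries.coeff n (maclaurin h)) =
        linearizationCoeff (maclaurin F) := by
      refine (huniq _).mpr ⟨by simp only [coeff_zero_maclaurin, hh0],
        by simp only [coeff_one_maclaurin, hh1], fun k => ?_⟩
      rw [← coeff_maclaurin_comp hh hF hF0, maclaurin_congr heq, maclaurin_const_mul _ hh,
        PowerSeries.coeff_C_mul]
    obtain ⟨ρ, hρ⟩ := hh.hasFPowerSeriesAt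
    obtain ⟨r, hr0, hr⟩ := ENNReal.lt_iff_exists_nnreal_btwn.mp (hρ.r_pos.trans_le hρ.r_le)
    obtain ⟨C, hC, hb⟩ := FormalMultilinearSeries.norm_mul_pow_le_of_lt_radius _ hr
    have hr0' : (0 : ℝ) < r := by exact_mod_cast hr0
    refine ⟨max C 1 / r, fun n hn => ?_⟩
    have hbn := hb n
    rw [FormalMultilinearSeries.norm_apply_eq_norm_coef,
      FormalMultilinearSeries.coeff_ofScalars, ← coeff_maclaurin] at hbn
    rw [← hcoeff, div_pow, le_div_iff₀ (by positivity)]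
    calc _ ≤ C := hbn
      _ ≤ max C 1 := le_max_left _ _
      _ ≤ max C 1 ^ n := le_self_pow₀ (le_max_right _ _) hn.ne'
  · rintro ⟨C, hC⟩
    set c := linearizationCoeff (maclaurin F) with hc
    obtain ⟨hc0, hc1, hck⟩ := (huniq c).mp rfl
    let p : FormalMultilinearSeries ℂ ℂ ℂ := FormalMultilinearSeries.ofScalars ℂ c
    let K : ℝ≥0 := ⟨max |C| 1, by positivity⟩
    have hK : (1 : ℝ) ≤ K := le_max_right _ _
    have hrad : 0 < p.radius := by
      have : ((K⁻¹ : ℝ≥0) : ℝ≥0∞) ≤ p.radius := by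
        refine p.le_radius_of_bound 1 fun n => ?_
        rw [FormalMultilinearSeries.norm_apply_eq_norm_coef,
          FormalMultilinearSeries.coeff_ofScalars, NNReal.coe_inv, inv_pow,
          mul_inv_le_iff₀ (by positivity), one_mul]
        rcases Nat.eq_zero_or_pos n with rfl | hn
        · simp [hc0]
        · refine (hC n hn).trans ((le_abs_self _).trans ?_)
          rw [abs_pow]
          exact pow_le_pow_left₀ (abs_nonneg _) (le_max_left _ _) n
      refine lt_of_lt_of_le ?_ this
      have : 0 < K := lt_of_lt_of_le one_pos hK
      simpa using this
    have hps := (p.hasFPowerSeriesOnBall hrad).hasFPowerSeriesAt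
    have han : AnalyticAt ℂ p.sum 0 := hps.analyticAt
    have hcoeff : ∀ n, PowerSeries.coeff n (maclaurin p.sum) = c n := by
      intro n
      have := congrArg (fun q => FormalMultilinearSeries.coeff q n)
        (han.hasFPowerSeriesAt.eq_formalMultilinearSeries hps)
      simpa only [p, FormalMultilinearSeries.coeff_ofScalars, ← coeff_maclaurin] using this
    refine ⟨p.sum, han, ?_, ?_, ?_⟩
    · rw [← coeff_zero_maclaurin p.sum, hcoeff, hc0]
    · rw [← coeff_one_maclaurin p.sum, hcoeff, hc1]
    · refine eventuallyEq_of_maclaurin_eq (AnalyticAt.fun_comp (by rwa [hF0]) hF)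
        (analyticAt_const.fun_mul han) ?_
      ext k
      rw [coeff_maclaurin_comp han hF hF0, maclaurin_const_mul _ han, PowerSeries.coeff_C_mul]
      simp only [hcoeff, hck]

end

section

variable {V : Type*} [NormedAddCommGroup V] [NormedSpace ℂ V] {d : ℕ} {φ : V → PowerSeries ℂ}
  {lam : ℂ}

/-- In a product of `n` coefficients of `φ t` with indices adding up to `k`, at most `k - n` of the
indices exceed `1`, and only these contribute to the degree. -/
lemma isPolynomialOnLines_coeff_pow (h0 : ∀ t, PowerSeries.coeff 0 (φ t) = 0)
    (hφ : ∀ k, 0 < k → IsPolynomialOnLines (d * (k - 1)) fun t => PowerSeries.coeff k (φ t))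
    (k n : ℕ) : IsPolynomialOnLines (d * (k - n)) fun t => PowerSeries.coeff k (φ t ^ n) := by
  induction n generalizing k with
  | zero => simpa using IsPolynomialOnLines.const _ _
  | succ n ih =>
    simp only [pow_succ, PowerSeries.coeff_mul]
    refine IsPolynomialOnLines.sum _ fun ij hij => ?_
    rw [Finset.HasAntidiagonal.mem_antidiagonal] at hij
    by_cases hi : ij.1 < n
    · simpa only [coeff_pow_of_lt (h0 _) hi, zero_mul] using IsPolynomialOnLines.const _ 0
    rcases Nat.eq_zero_or_pos ij.2 with hj | hj
    · simpa only [hj, h0, mul_zero] using IsPolynomialOnLines.const _ 0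
    refine ((ih ij.1).mul (hφ ij.2 hj)).mono ?_
    rw [← mul_add]
    exact Nat.mul_le_mul_left _ (by omega)

lemma isPolynomialOnLines_linearizationCoeff (h0 : ∀ t, PowerSeries.coeff 0 (φ t) = 0)
    (h1 : ∀ t, PowerSeries.coeff 1 (φ t) = lam)
    (hφ : ∀ k, 0 < k → IsPolynomialOnLines (d * (k - 1)) fun t => PowerSeries.coeff k (φ t))
    (k : ℕ) : IsPolynomialOnLines (d * (k - 1)) fun t => linearizationCoeff (φ t) k := by
  induction k using Nat.strong_induction_on with
  | _ k ih =>
    match k with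
    | 0 => simpa only [linearizationCoeff] using IsPolynomialOnLines.const _ 0
    | 1 => simpa only [linearizationCoeff] using IsPolynomialOnLines.const _ 1
    | k + 2 =>
      simp only [linearizationCoeff_of_two_le _ (show 2 ≤ k + 2 by omega), h1, div_eq_inv_mul]
      refine (IsPolynomialOnLines.sum _ fun n hn => ?_).const_mul _
      rw [Finset.mem_range] at hn
      rcases Nat.eq_zero_or_pos n with rfl | hn0
      · simpa only [linearizationCoeff, zero_mul] using IsPolynomialOnLines.const _ 0
      refine ((ih n hn).mul (isPolynomialOnLines_coeff_pow h0 hφ (k + 2) n)).mono ?_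
      rw [← mul_add]
      exact Nat.mul_le_mul_left _ (by omega)

end

/-! ### Polynomial families -/

lemma exp_pow_ne_self {α : ℝ} (hα : Irrational α) {k : ℕ} (hk : 2 ≤ k) :
    Complex.exp (2 * Real.pi * Complex.I * α) ^ k ≠ Complex.exp (2 * Real.pi * Complex.I * α) := by
  intro h
  rw [← Complex.exp_nat_mul, Complex.exp_eq_exp_iff_exists_int] at h
  obtain ⟨n, hn⟩ := h
  have h2 : (2 * Real.pi * Complex.I : ℂ) ≠ 0 := Complex.two_pi_I_ne_zero
  have h3 : ((k - 1 : ℝ) : ℂ) * α = n := by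
    refine mul_left_cancel₀ h2 ?_
    push_cast
    linear_combination hn
  have h4 : (k - 1 : ℝ) * α = n := by exact_mod_cast h3
  have h5 : (k - 1 : ℝ) ≠ 0 := by
    have : (2 : ℝ) ≤ k := by exact_mod_cast hk
    linarith
  refine hα ⟨(n : ℚ) / ((k : ℚ) - 1), ?_⟩
  push_cast
  rw [← h4]
  field_simp

section

variable {m d : ℕ} {lam : ℂ} {f : (Fin m → ℕ) → ℂ → ℂ}

lemma sum_le_of_mem_multiIndices {i : Fin m → ℕ} (hi : i ∈ multiIndices m d) : ∑ j, i j ≤ d :=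
  (Finset.mem_filter.mp hi).2

lemma analyticAt_polynomialFamily (hf : ∀ i ∈ multiIndices m d, Differentiable ℂ (f i))
    (t : EuclideanSpace ℂ (Fin m)) : AnalyticAt ℂ (polynomialFamily lam d f t) 0 :=
  (analyticAt_const.fun_mul analyticAt_id).fun_add (Finset.analyticAt_fun_sum _ fun i hi =>
    analyticAt_const.fun_mul ((hf i hi).analyticAt 0))

lemma coeff_maclaurin_polynomialFamily (hf : ∀ i ∈ multiIndices m d, Differentiable ℂ (f i))
    (t : EuclideanSpace ℂ (Fin m)) (k : ℕ) :
    PowerSeries.coeff k (maclaurin (polynomialFamily lam d f t)) =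
      (if k = 1 then lam else 0) + ∑ i ∈ multiIndices m d,
        (∏ j, t j ^ i j) * PowerSeries.coeff k (maclaurin (f i)) := by
  have hterm : ∀ i ∈ multiIndices m d, AnalyticAt ℂ (fun z => (∏ j, t j ^ i j) * f i z) 0 :=
    fun i hi => analyticAt_const.fun_mul ((hf i hi).analyticAt 0)
  have hlin : AnalyticAt ℂ (fun z : ℂ => lam * z) 0 := analyticAt_const.fun_mul analyticAt_id
  have h1 : maclaurin (polynomialFamily lam d f t) = PowerSeries.C lam * PowerSeries.X +
      ∑ i ∈ multiIndices m d, PowerSeries.C (∏ j, t j ^ i j) * maclaurin (f i) := by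
    rw [← maclaurin_id, ← maclaurin_const_mul lam (F := fun z => z) analyticAt_id,
      Finset.sum_congr rfl fun i hi => (maclaurin_const_mul _ ((hf i hi).analyticAt 0)).symm,
      ← maclaurin_sum _ hterm, ← maclaurin_add hlin (Finset.analyticAt_fun_sum _ hterm)]
    rfl
  simp only [h1, map_add, map_sum, PowerSeries.coeff_C_mul, PowerSeries.coeff_X, mul_ite, mul_one,
    mul_zero]

lemma isPolynomialOnLines_coeff_polynomialFamily
    (hf : ∀ i ∈ multiIndices m d, Differentiable ℂ (f i)) (k : ℕ) :
    IsPolynomialOnLines d fun t =>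
      PowerSeries.coeff k (maclaurin (polynomialFamily lam d f t)) := by
  simp only [coeff_maclaurin_polynomialFamily hf]
  refine (IsPolynomialOnLines.const _ _).add (IsPolynomialOnLines.sum _ fun i hi => ?_)
  simp only [mul_comm _ (PowerSeries.coeff k _)]
  refine IsPolynomialOnLines.const_mul _ (IsPolynomialOnLines.mono ?_
    (sum_le_of_mem_multiIndices hi))
  refine IsPolynomialOnLines.prod _ fun j _ => ?_
  simpa using (IsPolynomialOnLines.clm
    (EuclideanSpace.proj j : EuclideanSpace ℂ (Fin m) →L[ℂ] ℂ)).pow (i j)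

end

theorem corollary1 (m d : ℕ) (α : ℝ) (hα : Irrational α)
    (f : (Fin m → ℕ) → ℂ → ℂ)
    (hf : ∀ i ∈ multiIndices m d, Differentiable ℂ (f i) ∧ f i 0 = 0 ∧ deriv (f i) 0 = 0) :
    (∀ t : EuclideanSpace ℂ (Fin m),
      IsLinearizable (polynomialFamily (Complex.exp (2 * Real.pi * Complex.I * α)) d f t)) ∨
    ∃ E : Set (EuclideanSpace ℂ (Fin m)), IsPolar E ∧ GammaCapacityZero E ∧
      ∀ t ∉ E,
        ¬ IsLinearizable
          (polynomialFamily (Complex.exp (2 * Real.pi * Complex.I * α)) d f t) := by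
  set lam := Complex.exp (2 * Real.pi * Complex.I * α) with hlam
  have hd : ∀ i ∈ multiIndices m d, Differentiable ℂ (f i) := fun i hi => (hf i hi).1
  let φ : EuclideanSpace ℂ (Fin m) → PowerSeries ℂ := fun t =>
    maclaurin (polynomialFamily lam d f t)
  have h0 : ∀ t, PowerSeries.coeff 0 (φ t) = 0 := fun t => by
    rw [coeff_maclaurin_polynomialFamily hd, if_neg zero_ne_one, zero_add]
    exact Finset.sum_eq_zero fun i hi => by rw [coeff_zero_maclaurin, (hf i hi).2.1, mul_zero]
  have h1 : ∀ t, PowerSeries.coeff 1 (φ t) = lam := fun t => by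
    rw [coeff_maclaurin_polynomialFamily hd, if_pos rfl, Finset.sum_eq_zero fun i hi => by
      rw [coeff_one_maclaurin, (hf i hi).2.2, mul_zero], add_zero]
  have hφ : ∀ k, 0 < k →
      IsPolynomialOnLines (d * (k - 1)) fun t => PowerSeries.coeff k (φ t) := fun k hk => by
    rcases Nat.lt_or_ge k 2 with hk2 | hk2
    · obtain rfl : k = 1 := by omega
      simpa only [h1] using IsPolynomialOnLines.const _ lam
    · exact (isPolynomialOnLines_coeff_polynomialFamily hd k).mono
        (Nat.le_mul_of_pos_right d (by omega))
  let h : ℕ → EuclideanSpace ℂ (Fin m) → ℂ := fun n t => linearizationCoeff (φ t) n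
  have hh : ∀ n, IsPolynomialOnLines (d * n) (h n) := fun n =>
    (isPolynomialOnLines_linearizationCoeff h0 h1 hφ n).mono
      (Nat.mul_le_mul_left _ (Nat.sub_le _ _))
  have hiff : ∀ t, IsLinearizable (polynomialFamily lam d f t) ↔ t ∈ boundedGrowthSet h := by
    intro t
    refine isLinearizable_iff (analyticAt_polynomialFamily hd t) ?_ fun k hk => ?_
    · rw [← coeff_zero_maclaurin (polynomialFamily lam d f t)]; exact h0 t
    · rw [← coeff_one_maclaurin (polynomialFamily lam d f t)]
      change PowerSeries.coeff 1 (φ t) ^ k ≠ PowerSeries.coeff 1 (φ t)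
      rw [h1]
      exact exp_pow_ne_self hα hk
  by_cases huniv : boundedGrowthSet h = Set.univ
  · exact Or.inl fun t => (hiff t).mpr (huniv ▸ Set.mem_univ t)
  · exact Or.inr ⟨boundedGrowthSet h, isPolar_boundedGrowthSet hh huniv,
      gammaCapacityZero_boundedGrowthSet hh huniv, fun t ht hlin => ht ((hiff t).mp hlin)⟩
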